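/- All graphs are finite, simple and undirected, and a path is a sequence of vertices in which consecutive vertices are adjacent (vertices may repeat); its length is its number of edges. A graph $H$ is an $r$-shallow minor of a graph $G$ if there is a family $(B_h)_{h\in V(H)}$ of pairwise vertex-disjoint connected subgraphs of $G$, each of radius at most $r$, such that for every edge $uv$ of $H$ there are $u'\in V(B_u)$ and $v'\in V(B_v)$ with $u'v'\in E(G)$. A class $\mathcal{C}$ of graphs is nowhere dense if for every $r\in\mathbb{N}$ there is $t\in\mathbb{N}$ such that the complete graph $K_t$ is not an $r$-shallow minor of any $G\in\mathcal{C}$. A set of vertices of $G$ is $r$-independent if any two distinct vertices of it are at distance greater than $r$ in $G$ (vertices in different components being at infinite distance). A $(k,r)$-witness in $G$ is a set $Q\subseteq V(G)$ such that for every $X\subseteq V(G)$ with $|X|=k$ there is a path of length at most $r$ in $G$ that joins two distinct vertices of $X$ and passes through a vertex of $Q$. Theorem 1.7 (Witness existence). Fix $k,r\in\mathbb{N}$ and a nowhere dense class of graphs $\mathcal{C}$. Then there is a constant $C$, depending only on $k$, $r$ and $\mathcal{C}$, such that every graph $G\in\mathcal{C}$ that has no $r$-independent set of size $k$ has a $(k,r)$-witness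 $Q\subseteq V(G)$ with $|Q|\le C$. -/

import Mathlib

universe u v

/-- A finite simple undirected graph, bundled with its vertex type. -/
structure FiniteGraph : Type (u + 1) where
  /-- The vertex set. -/
  V : Type u
  /-- There are finitely many vertices. -/
  finite : Finite V
  /-- The edge relation. -/
  graph : SimpleGraph V

/-- A model of `H` as an `r`-shallow minor of `G`: a family of pairwise vertex-disjoint connected
subgraphs of `G`, one for each vertex of `H`, each of radius at most `r` (measured inside the
subgraph), such that for every edge `uv` of `H` some edge of `G` joins the subgraph of `u` to the
subgraph of `v`. -/
structure IsShallowMinorModel {W : Type v} {V : Type u} (r : ℕ) (H : SimpleGraph W)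
    (G : SimpleGraph V) (B : W → G.Subgraph) : Prop where
  connected : ∀ h, (B h).Connected
  disjoint : ∀ g h, g ≠ h → Disjoint (B g).verts (B h).verts
  radius_le : ∀ h, (B h).coe.radius ≤ (r : ℕ∞)
  exists_adj : ∀ g h, H.Adj g h → ∃ x ∈ (B g).verts, ∃ y ∈ (B h).verts, G.Adj x y

/-- `H` is an `r`-shallow minor of `G`. -/
def IsShallowMinor {W : Type v} {V : Type u} (r : ℕ) (H : SimpleGraph W)
    (G : SimpleGraph V) : Prop :=
  ∃ B : W → G.Subgraph, IsShallowMinorModel r H G B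

/-- A class of finite graphs is nowhere dense if for every `r` there is `t` such that the clique on
`t` vertices is not an `r`-shallow minor of any graph of the class. -/
def IsNowhereDenseClass (𝒞 : Set FiniteGraph.{u}) : Prop :=
  ∀ r : ℕ, ∃ t : ℕ, ∀ G ∈ 𝒞, ¬ IsShallowMinor r (⊤ : SimpleGraph (Fin t)) G.graph

/-- A set of vertices is `r`-independent if any two distinct vertices of it are at distance greater
than `r` (the distance is infinite between different connected components). -/
def IsRIndependent {V : Type u} (G : SimpleGraph V) (r : ℕ) (A : Set V) : Prop :=
  ∀ x ∈ A, ∀ y ∈ A, x ≠ y → (r : ℕ∞) < G.edist x y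

/-- `Q` captures `Y` (with respect to `r`): two different vertices of `Y` are connected by a path
of length at most `r` that passes through a vertex of `Q`. As is common in this setting, a path may
repeat vertices, so that `Q` captures `Y` if and only if `dist x q + dist q y ≤ r` for some `q` in
`Q` and some distinct `x`, `y` in `Y`. -/
def Captures {V : Type u} (G : SimpleGraph V) (r : ℕ) (Q Y : Set V) : Prop :=
  ∃ x ∈ Y, ∃ y ∈ Y, x ≠ y ∧ ∃ p : G.Walk x y, p.length ≤ r ∧ ∃ q ∈ Q, q ∈ p.support

/-- `Q` is a `(k, r)`-witness in `G`: it captures every set of `k` vertices. -/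
def IsWitness {V : Type u} (G : SimpleGraph V) (k r : ℕ) (Q : Set V) : Prop :=
  ∀ X : Finset V, X.card = k → Captures G r Q (X : Set V)

/-! The proof is by compactness. If no bound `C` works, take for each `n` a counterexample graph
with no witness of size at most `n`, and form the ultraproduct `H`. Excluded shallow cliques and the
absence of `r`-independent `k`-tuples pass to `H`. A finite capturing set in `H` then yields, in
coordinate `n`, a set of bounded size capturing a tuple it was chosen to miss.

For the infinite graph (`exists_finset_forall_capturesTuple`), failure gives tuples `X n` and finite
sets `Q m` that realize every truncated distance profile over `X 0, ..., X m` but capture no later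
tuple. Wideness (`exists_finite_eventually_not_joined`) gives a finite `S` outside which each
coordinate sequence is scattered. A diagonal tuple has two entries joined by a short walk, which
must meet `S`; hence some `s ∈ S` captures almost all `X n`. A vertex `q ∈ Q m` imitating `s` has
walks forced through `S`, and these can be redirected to later tuples, so `q` captures one of them.
-/

open Filter

/-! ### Bounded walks inside a vertex set -/

/-- `x` and `y` are joined by a walk with at most `d` edges all of whose vertices lie in `A`. -/
def WalkJoined {V : Type u} (G : SimpleGraph V) (A : Set V) : ℕ → V → V → Prop
  | 0, x, y => x = y ∧ y ∈ A
  | d + 1, x, y => ∃ z, WalkJoined G A d x z ∧ (z = y ∨ G.Adj z y) ∧ y ∈ A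

namespace WalkJoined

variable {V : Type u} {G : SimpleGraph V} {A B S : Set V} {d e : ℕ} {x y z : V}

theorem refl (hx : x ∈ A) : WalkJoined G A 0 x x := ⟨rfl, hx⟩

theorem right_mem (h : WalkJoined G A d x y) : y ∈ A := by
  cases d with
  | zero => exact h.2
  | succ d => obtain ⟨z, _, _, h⟩ := h; exact h

theorem left_mem (h : WalkJoined G A d x y) : x ∈ A := by
  induction d generalizing y with
  | zero => exact h.1 ▸ h.2
  | succ d ih => obtain ⟨z, h, _⟩ := h; exact ih h

theorem mono (hAB : A ⊆ B) (h : WalkJoined G A d x y) : WalkJoined G B d x y := by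
  induction d generalizing y with
  | zero => exact ⟨h.1, hAB h.2⟩
  | succ d ih => obtain ⟨z, h, hz, hy⟩ := h; exact ⟨z, ih h, hz, hAB hy⟩

theorem succ (h : WalkJoined G A d x y) : WalkJoined G A (d + 1) x y :=
  ⟨y, h, Or.inl rfl, h.right_mem⟩

theorem le (hde : d ≤ e) (h : WalkJoined G A d x y) : WalkJoined G A e x y := by
  induction hde with
  | refl => exact h
  | step _ ih => exact ih.succ

theorem trans (h₁ : WalkJoined G A d x y) (h₂ : WalkJoined G A e y z) :
    WalkJoined G A (d + e) x z := by
  induction e generalizing z with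
  | zero => exact h₂.1 ▸ h₁
  | succ e ih => obtain ⟨w, h, hw, hz⟩ := h₂; exact ⟨w, ih h, hw, hz⟩

theorem symm (h : WalkJoined G A d x y) : WalkJoined G A d y x := by
  induction d generalizing y with
  | zero => exact ⟨h.1.symm, h.1 ▸ h.2⟩
  | succ d ih =>
    obtain ⟨z, h, hz, hy⟩ := h
    have h₁ : WalkJoined G A 1 y z :=
      ⟨y, refl hy, hz.imp Eq.symm fun h => h.symm, h.right_mem⟩
    simpa [add_comm] using h₁.trans (ih h)

theorem split (h : WalkJoined G A (d + e) x z) :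
    ∃ y, WalkJoined G A d x y ∧ WalkJoined G A e y z := by
  induction e generalizing z with
  | zero => exact ⟨z, h, refl h.right_mem⟩
  | succ e ih =>
    obtain ⟨w, h, hw, hz⟩ := h
    obtain ⟨y, h₁, h₂⟩ := ih h
    exact ⟨y, h₁, w, h₂, hw, hz⟩

theorem of_ball (hB : ∀ v, WalkJoined G A d x v → v ∈ B) (h : WalkJoined G A d x y) :
    WalkJoined G B d x y := by
  induction d generalizing y with
  | zero => exact ⟨h.1, hB _ h⟩
  | succ d ih =>
    have hy := hB _ h
    obtain ⟨z, h, hz, _⟩ := h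
    exact ⟨z, ih (fun v hv => hB v hv.succ) h, hz, hy⟩

theorem of_ball_succ (hB : ∀ v, WalkJoined G A d x v → v ∈ B) (hy : y ∈ B)
    (h : WalkJoined G A (d + 1) x y) : WalkJoined G B (d + 1) x y := by
  obtain ⟨z, h, hz, _⟩ := h
  exact ⟨z, h.of_ball hB, hz, hy⟩

theorem exists_adj (h : WalkJoined G A (d + 1) x y) (hn : ¬ WalkJoined G A d x y) :
    ∃ z, WalkJoined G A d x z ∧ G.Adj z y := by
  obtain ⟨z, h, hz | hz, _⟩ := h
  · exact absurd (hz ▸ h) hn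
  · exact ⟨z, h, hz⟩

/-- Cut the walk at a vertex where it meets `S`. The lengths add up to exactly `d`, so the second
piece can later be replaced without loss. -/
theorem exists_mem_of_not (h : WalkJoined G Set.univ d x y) (hn : ¬ WalkJoined G Sᶜ d x y) :
    ∃ s ∈ S, ∃ p q, p + q = d ∧ WalkJoined G Set.univ p x s ∧ WalkJoined G Set.univ q s y := by
  induction d generalizing y with
  | zero =>
    refine ⟨y, ?_, 0, 0, rfl, h, refl trivial⟩
    by_contra hy
    exact hn ⟨h.1, hy⟩
  | succ d ih =>
    have h' := h
    obtain ⟨z, h, hz, _⟩ := h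
    by_cases hxz : WalkJoined G Sᶜ d x z
    · refine ⟨y, ?_, d + 1, 0, rfl, h', refl trivial⟩
      by_contra hy
      exact hn ⟨z, hxz, hz, hy⟩
    · obtain ⟨s, hs, p, q, hpq, h₁, h₂⟩ := ih h hxz
      exact ⟨s, hs, p, q + 1, by omega, h₁, z, h₂, hz, trivial⟩

theorem exists_finite (h : WalkJoined G A d x y) :
    ∃ F ⊆ A, F.Finite ∧ WalkJoined G F d x y := by
  induction d generalizing y with
  | zero => exact ⟨{y}, by simpa using h.2, Set.finite_singleton y, h.1, rfl⟩
  | succ d ih =>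
    obtain ⟨z, h, hz, hy⟩ := h
    obtain ⟨F, hFA, hF, h⟩ := ih h
    exact ⟨insert y F, Set.insert_subset hy hFA, hF.insert y, z,
      h.mono (Set.subset_insert y F), hz, Set.mem_insert y F⟩

theorem exists_walk (h : WalkJoined G A d x y) : ∃ p : G.Walk x y, p.length ≤ d := by
  induction d generalizing y with
  | zero => obtain ⟨rfl, _⟩ := h; exact ⟨.nil, le_rfl⟩
  | succ d ih =>
    obtain ⟨z, h, hz | hz, _⟩ := h
    · obtain ⟨p, hp⟩ := ih h
      exact ⟨p.copy rfl hz, by simp; omega⟩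
    · obtain ⟨p, hp⟩ := ih h
      exact ⟨p.concat hz, by simp; omega⟩

theorem of_walk (p : G.Walk x y) : WalkJoined G Set.univ p.length x y := by
  induction p with
  | nil => exact refl trivial
  | cons h p ih =>
    have h₁ : WalkJoined G Set.univ 1 _ _ := ⟨_, refl trivial, Or.inr h, trivial⟩
    simpa [add_comm] using h₁.trans ih

theorem induce_coe (h : WalkJoined G A d x y) :
    ∃ p : ((⊤ : G.Subgraph).induce A).coe.Walk ⟨x, h.left_mem⟩ ⟨y, h.right_mem⟩,
      p.length ≤ d := by
  induction d generalizing y with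
  | zero => obtain ⟨rfl, _⟩ := h; exact ⟨.nil, le_rfl⟩
  | succ d ih =>
    have hx := h.left_mem
    obtain ⟨z, h, hz | hz, hy⟩ := h
    · subst hz
      obtain ⟨p, hp⟩ := ih h
      exact ⟨p, by omega⟩
    · obtain ⟨p, hp⟩ := ih h
      refine ⟨p.concat (?_ : _ ), by rw [SimpleGraph.Walk.length_concat]; omega⟩
      simp [hz, hy, h.right_mem]

end WalkJoined

/-! ### Shallow clique models and subsequences -/

/-- A model of the complete graph on `t` vertices as an `r`-shallow minor of `G`, given by centres
`c` and disjoint sets `O`. -/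
def HasCliqueModel {V : Type u} (G : SimpleGraph V) (r t : ℕ) : Prop :=
  ∃ (c : Fin t → V) (O : Fin t → Set V), (∀ h, c h ∈ O h) ∧
    (∀ g h, g < h → Disjoint (O g) (O h)) ∧
    ∀ g h, g < h → ∃ x y, WalkJoined G (O g) r (c g) x ∧ WalkJoined G (O h) r (c h) y ∧ G.Adj x y

/-- Shrinking each `O h` to its radius-`r` ball around `c h` makes it connected of radius at most
`r` and keeps the endpoints of the required edges. -/
theorem HasCliqueModel.isShallowMinor {V : Type u} {G : SimpleGraph V} {r t : ℕ}
    (hG : HasCliqueModel G r t) : IsShallowMinor r (⊤ : SimpleGraph (Fin t)) G := by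
  obtain ⟨c, O, hc, hO, hadj⟩ := hG
  let A : Fin t → Set V := fun h => {v | WalkJoined G (O h) r (c h) v}
  have hcA : ∀ h, c h ∈ A h := fun h => (WalkJoined.refl (hc h)).le (Nat.zero_le r)
  have hw : ∀ h, ∀ v : ((⊤ : G.Subgraph).induce (A h)).verts,
      ∃ p : ((⊤ : G.Subgraph).induce (A h)).coe.Walk ⟨c h, hcA h⟩ v, p.length ≤ r :=
    fun h v => (WalkJoined.of_ball (B := A h) (fun _ h => h) v.2).induce_coe
  have hAO : ∀ h, A h ⊆ O h := fun h v hv => WalkJoined.right_mem hv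
  refine ⟨fun h => (⊤ : G.Subgraph).induce (A h), ⟨fun h => ?_, fun g h hgh => ?_, fun h => ?_, ?_⟩⟩
  · rw [SimpleGraph.Subgraph.connected_iff']
    have : Nonempty ((⊤ : G.Subgraph).induce (A h)).verts := ⟨⟨c h, hcA h⟩⟩
    refine ⟨fun v w => ?_⟩
    obtain ⟨p, _⟩ := hw h v
    obtain ⟨q, _⟩ := hw h w
    exact ⟨p.reverse.append q⟩
  · rcases lt_or_gt_of_ne hgh with hlt | hlt
    · exact (hO g h hlt).mono (hAO g) (hAO h)
    · exact (hO h g hlt).symm.mono (hAO g) (hAO h)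
  · refine (SimpleGraph.radius_le_eccent (u := ⟨c h, hcA h⟩)).trans ?_
    rw [SimpleGraph.eccent_le_iff]
    intro v
    obtain ⟨p, hp⟩ := hw h v
    exact p.edist_le.trans (by exact_mod_cast hp)
  · intro g h hgh
    rcases lt_or_gt_of_ne hgh.ne with hlt | hlt
    · obtain ⟨x, y, hx, hy, hxy⟩ := hadj g h hlt
      exact ⟨x, hx, y, hy, hxy⟩
    · obtain ⟨x, y, hx, hy, hxy⟩ := hadj h g hlt
      exact ⟨y, hy, x, hx, hxy.symm⟩

/-- Ramsey-type extraction of a subsequence along a filter finer than `atTop`. -/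
theorem exists_subseq_of_eventually {l : Filter ℕ} [l.NeBot] (hl : l ≤ atTop)
    {P : ℕ → ℕ → Prop} {Q : ℕ → ℕ → ℕ → Prop} (hP : ∀ᶠ a in l, ∀ᶠ b in l, P a b)
    (hQ : ∀ a b, ∀ᶠ c in l, Q a b c) :
    ∃ g : ℕ → ℕ, StrictMono g ∧ (∀ i j, i < j → P (g i) (g j)) ∧
      ∀ i j m, i < m → j < m → Q (g i) (g j) (g m) := by
  obtain ⟨g, -, hg⟩ := exists_seq_of_forall_finset_exists (fun a => ∀ᶠ b in l, P a b)
    -- The extraction principle handles only binary relations; bounding `i` and `j` by the value `a`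
    -- makes `Q` cover every pair chosen so far.
    (fun a b => a < b ∧ P a b ∧ ∀ i ≤ a, ∀ j ≤ a, Q i j b) (by
      intro s hs
      have h : ∀ᶠ b in l, (∀ᶠ c in l, P b c) ∧
          ∀ a ∈ s, a < b ∧ P a b ∧ ∀ i ∈ Set.Iic a, ∀ j ∈ Set.Iic a, Q i j b := by
        refine hP.and ((eventually_all_finset s).2 fun a ha => ?_)
        refine ((eventually_gt_atTop a).filter_mono hl).and ((hs a ha).and ?_)
        exact (eventually_all_finite (Set.finite_Iic a)).2 fun i _ =>
          (eventually_all_finite (Set.finite_Iic a)).2 fun j _ => hQ i j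
      exact h.exists)
  have hmono : StrictMono g := fun i j hij => (hg i j hij).1
  refine ⟨g, hmono, fun i j hij => (hg i j hij).2.1, fun i j m hi hj => ?_⟩
  exact (hg _ _ (max_lt hi hj)).2.2 _ (hmono.monotone (le_max_left i j)) _
    (hmono.monotone (le_max_right i j))

/-! ### Uniform quasi-wideness along an ultrafilter -/

section Wideness

variable {V : Type u} {G : SimpleGraph V} {U : Ultrafilter ℕ} {f : ℕ → V} {S : Set V} {i t : ℕ}

/-- Otherwise a subsequence has all pairs at distance exactly `2 * i + 1`, and its radius-`i` balls
are disjoint and pairwise adjacent. -/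
theorem eventually_not_joined_succ (hU : (U : Filter ℕ) ≤ atTop) (hG : ¬ HasCliqueModel G i t)
    (hf : ∀ᶠ a in U, ∀ᶠ b in U, ¬ WalkJoined G S (2 * i) (f a) (f b)) :
    ∀ᶠ a in U, ∀ᶠ b in U, ¬ WalkJoined G S (2 * i + 1) (f a) (f b) := by
  by_contra hcon
  simp only [Ultrafilter.eventually_not, not_not] at hcon
  obtain ⟨g, -, hg, -⟩ := exists_subseq_of_eventually hU (Q := fun _ _ _ => True)
    (hf.and hcon |>.mono fun a h => h.1.and h.2) (fun _ _ => .of_forall fun _ => trivial)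
  refine hG ⟨fun h => f (g h), fun h => {v | WalkJoined G S i (f (g h)) v}, fun h => ?_,
    fun h l hhl => ?_, fun h l hhl => ?_⟩
  · exact (WalkJoined.refl (hg h (h + 1) (Nat.lt_succ_self _)).2.left_mem).le (Nat.zero_le i)
  · refine Set.disjoint_left.2 fun v hv hv' => (hg h l hhl).1 ?_
    exact two_mul i ▸ WalkJoined.trans hv (WalkJoined.symm hv')
  · obtain ⟨x, hx, hxl⟩ := WalkJoined.split (d := i) (e := i + 1)
      (show WalkJoined G S (i + (i + 1)) (f (g h)) (f (g l)) by
        rw [← add_assoc, ← two_mul]; exact (hg h l hhl).2)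
    obtain ⟨y, hy, hyx⟩ := hxl.symm.exists_adj fun hn =>
      (hg h l hhl).1 (two_mul i ▸ hx.trans hn.symm)
    exact ⟨x, y, hx.of_ball fun _ h => h, hy.of_ball fun _ h => h, hyx.symm⟩

/-- Given `t` such vertices `v h`, pick `t` terms near all of them. The radius-`i` balls, each
enlarged by its own `v h`, form a clique model: `v h` is adjacent to every other ball. -/
theorem finite_setOf_eventually_joined (hU : (U : Filter ℕ) ≤ atTop)
    (hG : ¬ HasCliqueModel G (i + 1) t)
    (hf : ∀ᶠ a in U, ∀ᶠ b in U, ¬ WalkJoined G S (2 * i + 1) (f a) (f b)) :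
    {v | ∀ᶠ a in U, WalkJoined G S (i + 1) (f a) v}.Finite := by
  by_contra hinf
  let v := Set.Infinite.natEmbedding _ hinf
  have hv : ∀ᶠ a in U, ∀ h : Fin t, WalkJoined G S (i + 1) (f a) (v h) :=
    eventually_all.2 fun h => (v h).2
  obtain ⟨g, -, hg, -⟩ := exists_subseq_of_eventually hU (Q := fun _ _ _ => True)
    (P := fun a b => ¬ WalkJoined G S (2 * i + 1) (f a) (f b) ∧
      ∀ h : Fin t, WalkJoined G S (i + 1) (f a) (v h))
    (hf.and hv |>.mono fun a h => h.1.and (.of_forall fun _ => h.2))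
    (fun _ _ => .of_forall fun _ => trivial)
  have hgv : ∀ n (h : Fin t), WalkJoined G S (i + 1) (f (g n)) (v h) := fun n =>
    (hg n (n + 1) (Nat.lt_succ_self _)).2
  have hne : ∀ m n, m ≠ n → ¬ WalkJoined G S (2 * i + 1) (f (g m)) (f (g n)) := by
    intro m n hmn h
    rcases lt_or_gt_of_ne hmn with hlt | hlt
    · exact (hg m n hlt).1 h
    · exact (hg n m hlt).1 h.symm
  have hball : ∀ m n, m ≠ n → ∀ h : Fin t, ¬ WalkJoined G S i (f (g m)) (v h) := by
    intro m n hmn h hj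
    refine hne m n hmn ?_
    have := hj.trans (hgv n h).symm
    rwa [← add_assoc, ← two_mul] at this
  refine hG ⟨fun h => f (g h), fun h => insert (v h : V) {u | WalkJoined G S i (f (g h)) u},
    fun h => ?_, fun h l hhl => ?_, fun h l hhl => ?_⟩
  · exact Or.inr ((WalkJoined.refl (hgv h h).left_mem).le (Nat.zero_le i))
  · have hhl' : (h : ℕ) ≠ l := Nat.ne_of_lt hhl
    refine Set.disjoint_left.2 fun u hu hu' => ?_
    rcases hu with rfl | hu <;> rcases hu' with hu' | hu'
    · exact hhl' (v.injective (Subtype.ext hu'))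
    · exact hball l h hhl'.symm h hu'
    · subst hu'
      exact hball h l hhl' l hu
    · refine hne h l hhl' (WalkJoined.succ ?_)
      exact two_mul i ▸ WalkJoined.trans hu (WalkJoined.symm hu')
  · have hhl' : (h : ℕ) ≠ l := Nat.ne_of_lt hhl
    obtain ⟨y, hy, hyv⟩ := (hgv l h).exists_adj (hball l h hhl'.symm h)
    exact ⟨v h, y, (hgv h h).of_ball_succ (fun _ h => Or.inr h) (Or.inl rfl),
      (hy.of_ball fun _ h => Or.inr h).succ, hyv.symm⟩

/-- Otherwise pairs of terms have midpoints. By `hS` a subsequence keeps later terms away from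
earlier midpoints, so these are distinct across branch sets; each ball absorbs its midpoints with
earlier terms. -/
theorem eventually_not_joined_add_two (hU : (U : Filter ℕ) ≤ atTop)
    (hG : ¬ HasCliqueModel G (i + 1) t)
    (hf : ∀ᶠ a in U, ∀ᶠ b in U, ¬ WalkJoined G S (2 * i + 1) (f a) (f b))
    (hS : ∀ v, ∀ᶠ a in U, ¬ WalkJoined G S (i + 1) (f a) v) :
    ∀ᶠ a in U, ∀ᶠ b in U, ¬ WalkJoined G S (2 * i + 2) (f a) (f b) := by
  by_contra hcon
  simp only [Ultrafilter.eventually_not, not_not] at hcon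
  have hm : ∀ a b, ∃ m, WalkJoined G S (2 * i + 2) (f a) (f b) →
      WalkJoined G S (i + 1) (f a) m ∧ WalkJoined G S (i + 1) (f b) m := by
    intro a b
    by_cases h : WalkJoined G S (2 * i + 2) (f a) (f b)
    · rw [show 2 * i + 2 = (i + 1) + (i + 1) by ring] at h
      obtain ⟨m, h₁, h₂⟩ := h.split
      exact ⟨m, fun _ => ⟨h₁, h₂.symm⟩⟩
    · exact ⟨f a, fun h' => absurd h' h⟩
  choose m hm using hm
  obtain ⟨g, -, hg, hgm⟩ := exists_subseq_of_eventually hU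
    (Q := fun a b c => ¬ WalkJoined G S (i + 1) (f c) (m a b))
    (hf.and hcon |>.mono fun a h => h.1.and h.2) (fun a b => hS (m a b))
  have hne : ∀ m n, m ≠ n → ¬ WalkJoined G S (2 * i + 1) (f (g m)) (f (g n)) := by
    intro m n hmn h
    rcases lt_or_gt_of_ne hmn with hlt | hlt
    · exact (hg m n hlt).1 h
    · exact (hg n m hlt).1 h.symm
  have hne' : ∀ m n, m ≠ n → ∀ u, WalkJoined G S i (f (g m)) u →
      ¬ WalkJoined G S (i + 1) (f (g n)) u := by
    intro m n hmn u hu hu'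
    refine hne m n hmn ?_
    have := hu.trans hu'.symm
    rwa [← add_assoc, ← two_mul] at this
  have hgj : ∀ a b, a < b → WalkJoined G S (i + 1) (f (g a)) (m (g a) (g b)) ∧
      WalkJoined G S (i + 1) (f (g b)) (m (g a) (g b)) := fun a b hab => hm _ _ (hg a b hab).2
  refine hG ⟨fun h => f (g h), fun h => {u | WalkJoined G S i (f (g h)) u} ∪
    {u | ∃ a < (h : ℕ), u = m (g a) (g h)}, fun h => ?_, fun h l hhl => ?_, fun h l hhl => ?_⟩
  · exact Or.inl ((WalkJoined.refl (hgj h (h + 1) (Nat.lt_succ_self _)).1.left_mem).le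
      (Nat.zero_le i))
  · have hhl' : (h : ℕ) < l := hhl
    refine Set.disjoint_left.2 fun u hu hu' => ?_
    rcases hu with hu | ⟨a, ha, rfl⟩ <;> rcases hu' with hu' | ⟨b, hb, hu'⟩
    · exact hne' h l hhl'.ne u hu (WalkJoined.succ hu')
    · exact hne' h l hhl'.ne u hu (hu' ▸ (hgj b l hb).2)
    · exact hne' l h hhl'.ne' _ hu' (hgj a h ha).2
    · exact hgm a h l (ha.trans hhl') hhl' (hu' ▸ (hgj b l hb).2)
  · have hhl' : (h : ℕ) < l := hhl
    obtain ⟨x, hx, hxm⟩ := (hgj h l hhl').1.exists_adj fun hn =>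
      hne' h l hhl'.ne _ hn (hgj h l hhl').2
    exact ⟨x, m (g h) (g l), (hx.of_ball fun _ h => Or.inl h).succ,
      (hgj h l hhl').2.of_ball_succ (fun _ h => Or.inl h) (Or.inr ⟨h, hhl', rfl⟩), hxm⟩

/-- Uniform quasi-wideness, for sequences and along an ultrafilter: after the deletion of finitely
many vertices, almost all pairs of terms of the sequence are far apart. -/
theorem exists_finite_eventually_not_joined (hU : (U : Filter ℕ) ≤ atTop)
    (hG : ∀ r, ∃ t, ¬ HasCliqueModel G r t) (f : ℕ → V) (i : ℕ) :
    ∃ S : Set V, S.Finite ∧ ∀ᶠ a in U, ∀ᶠ b in U, ¬ WalkJoined G Sᶜ (2 * i) (f a) (f b) := by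
  induction i with
  | zero =>
    by_cases hv : ∃ v, ∀ᶠ a in U, f a = v
    · obtain ⟨v, hv⟩ := hv
      exact ⟨{v}, Set.finite_singleton v, .of_forall fun a => hv.mono fun b hb h => h.2 hb⟩
    · push Not at hv
      refine ⟨∅, Set.finite_empty, .of_forall fun a => ?_⟩
      exact (hv (f a)).mono fun b hb h => hb h.1.symm
  | succ i ih =>
    obtain ⟨S, hS, hf⟩ := ih
    obtain ⟨t, ht⟩ := hG i
    obtain ⟨t', ht'⟩ := hG (i + 1)
    have hf' := eventually_not_joined_succ hU ht hf
    have hW := finite_setOf_eventually_joined hU ht' hf'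
    refine ⟨_, hS.union hW, eventually_not_joined_add_two hU ht' ?_ ?_⟩
    · exact hf'.mono fun a ha => ha.mono fun b hb h =>
        hb (h.mono (Set.compl_subset_compl.2 Set.subset_union_left))
    · intro v
      -- A vertex near almost all terms has itself just been deleted.
      by_cases hv : ∀ᶠ a in U, WalkJoined G Sᶜ (i + 1) (f a) v
      · exact .of_forall fun a h => h.right_mem (Or.inr hv)
      · exact (Ultrafilter.eventually_not.2 hv).mono fun a ha h =>
          ha (h.mono (Set.compl_subset_compl.2 Set.subset_union_left))

end Wideness

/-! ### Witnesses in an infinite graph -/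

/-- `q` captures the tuple `X`: a walk of length at most `r` through `q` joins two of its entries. -/
def CapturesTuple {V : Type u} {k : ℕ} (G : SimpleGraph V) (r : ℕ) (q : V) (X : Fin k → V) : Prop :=
  ∃ a b, a ≠ b ∧ ∃ d e, d + e ≤ r ∧ WalkJoined G Set.univ d q (X a) ∧
    WalkJoined G Set.univ e q (X b)

theorem exists_finset_forall_exists_eq {α β : Type*} [Finite β] (f : α → β) :
    ∃ Q : Finset α, ∀ v, ∃ q ∈ Q, f q = f v := by
  classical
  obtain ⟨Q, -, hQ⟩ := Set.exists_subset_bijOn Set.univ f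
  have hfin : Q.Finite := Set.Finite.of_finite_image (Set.toFinite _) hQ.injOn
  refine ⟨hfin.toFinset, fun v => ?_⟩
  obtain ⟨q, hq, h⟩ := hQ.surjOn ⟨v, trivial, rfl⟩
  exact ⟨q, hfin.mem_toFinset.2 hq, h⟩

section

variable {V : Type u} {G : SimpleGraph V} {k r : ℕ}

/-- Finitely many vertices realize all truncated distance profiles over finitely many tuples. -/
theorem exists_finset_profile (T : Finset (Fin k → V)) :
    ∃ Q : Finset V, ∀ v, ∃ q ∈ Q, ∀ X ∈ T, ∀ a, ∀ d ≤ r,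
      WalkJoined G Set.univ d v (X a) → WalkJoined G Set.univ d q (X a) := by
  obtain ⟨Q, hQ⟩ := exists_finset_forall_exists_eq
    (fun v (p : T × Fin k × Fin (r + 1)) => WalkJoined G Set.univ p.2.2 v (p.1.1 p.2.1))
  refine ⟨Q, fun v => ?_⟩
  obtain ⟨q, hq, h⟩ := hQ v
  refine ⟨q, hq, fun X hX a d hd hv => ?_⟩
  exact (congrFun h (⟨X, hX⟩, a, ⟨d, Nat.lt_succ_of_le hd⟩)).symm ▸ hv

/-- The recursion runs over pairs whose first component accumulates the earlier tuples, so that a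
binary relation can refer to the whole past. -/
theorem exists_seq_not_captured
    (h : ∀ Q : Finset V, ∃ X : Fin k → V, ∀ q ∈ Q, ¬ CapturesTuple G r q X) :
    ∃ (X : ℕ → Fin k → V) (Q : ℕ → Finset V),
      (∀ m v, ∃ q ∈ Q m, ∀ i ≤ m, ∀ a, ∀ d ≤ r, WalkJoined G Set.univ d v (X i a) →
        WalkJoined G Set.univ d q (X i a)) ∧
      ∀ m n, m < n → ∀ q ∈ Q m, ¬ CapturesTuple G r q (X n) := by
  classical
  choose Q hQ using exists_finset_profile (G := G) (k := k) (r := r)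
  obtain ⟨F, -, hF⟩ := exists_seq_of_forall_finset_exists
    (α := Finset (Fin k → V) × (Fin k → V)) (fun _ => True)
    (fun p p' => insert p.2 p.1 ⊆ p'.1 ∧ ∀ q ∈ Q (insert p.2 p.1), ¬ CapturesTuple G r q p'.2) (by
      intro s _
      obtain ⟨X, hX⟩ := h (s.biUnion fun p => Q (insert p.2 p.1))
      refine ⟨(s.biUnion fun p => insert p.2 p.1, X), trivial, fun p hp =>
        ⟨Finset.subset_biUnion_of_mem (fun p : Finset (Fin k → V) × (Fin k → V) =>
          insert p.2 p.1) hp, fun q hq => hX q ?_⟩⟩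
      exact Finset.mem_biUnion.2 ⟨p, hp, hq⟩)
  refine ⟨fun n => (F n).2, fun n => Q (insert (F n).2 (F n).1), fun m v => ?_, fun m n hmn =>
    (hF m n hmn).2⟩
  obtain ⟨q, hq, hqv⟩ := hQ (insert (F m).2 (F m).1) v
  refine ⟨q, hq, fun i hi a d hd => hqv _ ?_ a d hd⟩
  rcases hi.eq_or_lt with rfl | hlt
  · exact Finset.mem_insert_self _ _
  · exact Finset.mem_insert_of_mem ((hF i m hlt).1 (Finset.mem_insert_self _ _))

/-- The witness theorem for a possibly infinite graph. -/
theorem exists_finset_forall_capturesTuple (hG : ∀ r, ∃ t, ¬ HasCliqueModel G r t)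
    (hi : ∀ y : Fin k → V, ∃ a b, a ≠ b ∧ WalkJoined G Set.univ r (y a) (y b)) :
    ∃ Q : Finset V, ∀ X : Fin k → V, ∃ q ∈ Q, CapturesTuple G r q X := by
  by_contra! hcon
  obtain ⟨X, Q, hQ, hX⟩ := exists_seq_not_captured hcon
  let U : Ultrafilter ℕ := hyperfilter ℕ
  have hU : (U : Filter ℕ) ≤ atTop := Nat.hyperfilter_le_atTop
  choose S₀ hS₀ hwide using fun a =>
    exists_finite_eventually_not_joined hU hG (fun n => X n a) r
  let S := ⋃ a, S₀ a
  have hS : S.Finite := Set.finite_iUnion hS₀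
  have hfar : ∀ᶠ i in U, ∀ᶠ j in U, ∀ a, ¬ WalkJoined G Sᶜ (2 * r) (X i a) (X j a) := by
    simp only [eventually_all]
    exact fun a => (hwide a).mono fun i hi => hi.mono fun j hj h =>
      hj (h.mono (Set.compl_subset_compl.2 (Set.subset_iUnion S₀ a)))
  have hfar' : ∀ v, ∀ᶠ j in U, ∀ a, ¬ WalkJoined G Sᶜ r v (X j a) := by
    intro v
    rw [eventually_all]
    intro a
    by_contra hv
    rw [Ultrafilter.eventually_not, not_not] at hv
    obtain ⟨i, hi, hvi⟩ := (hfar.and hv).exists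
    obtain ⟨j, hj, hvj⟩ := (hi.and hv).exists
    exact hj a (two_mul r ▸ hvi.symm.trans hvj)
  -- Each of the finitely many conditions holds for almost all indices or for almost none; drop the
  -- indices in the second case.
  have hgood : ∀ᶠ i in U, ∀ s ∈ S, ∀ a, ∀ d ≤ r, WalkJoined G Set.univ d s (X i a) →
      ∀ᶠ j in U, WalkJoined G Set.univ d s (X j a) := by
    refine (eventually_all_finite hS).2 fun s _ => eventually_all.2 fun a =>
      (eventually_all_finite (Set.finite_Iic r)).2 fun d _ => ?_
    by_cases h : ∀ᶠ j in U, WalkJoined G Set.univ d s (X j a)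
    · exact .of_forall fun _ _ => h
    · exact (Ultrafilter.eventually_not.2 h).mono fun i hi h' => absurd h' hi
  have hthrough : ∀ i, (∀ s ∈ S, ∀ a, ∀ d ≤ r, WalkJoined G Set.univ d s (X i a) →
      ∀ᶠ j in U, WalkJoined G Set.univ d s (X j a)) → ∀ v a, ∀ d ≤ r,
      WalkJoined G Set.univ d v (X i a) → ¬ WalkJoined G Sᶜ r v (X i a) →
      ∃ s ∈ S, ∃ p q, p + q = d ∧ WalkJoined G Set.univ p v s ∧
        ∀ᶠ j in U, WalkJoined G Set.univ q s (X j a) := by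
    intro i hi v a d hd hv hn
    obtain ⟨s, hs, p, q, hpq, h₁, h₂⟩ := hv.exists_mem_of_not fun h => hn (h.le hd)
    exact ⟨s, hs, p, q, hpq, h₁, hi s hs a q (by omega) h₂⟩
  -- Some vertex of `S` captures almost all of the tuples in the same way.
  obtain ⟨s, -, a, b, hab, d, e, hde, hsa, hsb⟩ : ∃ s ∈ S, ∃ a b, a ≠ b ∧ ∃ d e, d + e ≤ r ∧
      (∀ᶠ j in U, WalkJoined G Set.univ d s (X j a)) ∧
      ∀ᶠ j in U, WalkJoined G Set.univ e s (X j b) := by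
    obtain ⟨g, -, hg, -⟩ := exists_subseq_of_eventually hU (Q := fun _ _ _ => True)
      (hgood.mono fun i hi => (Eventually.of_forall fun _ => hi).and (hgood.and
        (eventually_all.2 fun a => hfar' (X i a))))
      (fun _ _ => .of_forall fun _ => trivial)
    have hgj := fun n => (hg n (n + 1) (Nat.lt_succ_self n)).1
    have key : ∀ a b : Fin k, a < b → WalkJoined G Set.univ r (X (g a) a) (X (g b) b) →
        ∃ s ∈ S, ∃ a b, a ≠ b ∧ ∃ d e, d + e ≤ r ∧
      (∀ᶠ j in U, WalkJoined G Set.univ d s (X j a)) ∧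
      ∀ᶠ j in U, WalkJoined G Set.univ e s (X j b) := by
      intro a b hab h
      obtain ⟨s, hs, p, q, hpq, h₁, h₂⟩ :=
        hthrough _ (hgj b) _ b r le_rfl h ((hg a b hab).2.2 a b)
      exact ⟨s, hs, a, b, hab.ne, p, q, hpq.le, hgj a s hs a p (by omega) h₁.symm, h₂⟩
    -- The diagonal tuple takes each coordinate from a different index, so `hfar'` forces its short
    -- walk through `S`.
    obtain ⟨a, b, hab, h⟩ := hi fun a => X (g a) a
    rcases lt_or_gt_of_ne hab with hlt | hlt
    · exact key a b hlt h
    · exact key b a hlt h.symm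
  have hearly : ∀ᶠ i in U, (∀ s ∈ S, ∀ a, ∀ d ≤ r, WalkJoined G Set.univ d s (X i a) →
      ∀ᶠ j in U, WalkJoined G Set.univ d s (X j a)) ∧
      WalkJoined G Set.univ d s (X i a) ∧ WalkJoined G Set.univ e s (X i b) :=
    hgood.and (hsa.and hsb)
  obtain ⟨g, -, hg, -⟩ := exists_subseq_of_eventually hU (Q := fun _ _ _ => True)
    ((hearly.and hfar).mono fun i hi => (Eventually.of_forall fun _ => hi.1).and hi.2)
    (fun _ _ => .of_forall fun _ => trivial)
  -- `Q m` must know the profiles over all three tuples used below.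
  let m := max (g 0) (max (g 1) (g 2))
  obtain ⟨q, hq, hqs⟩ := hQ m s
  -- At most one index is close to `q` outside `S` in a given coordinate.
  have hnear : ∀ c i j, i < j → WalkJoined G Sᶜ r q (X (g i) c) →
      ¬ WalkJoined G Sᶜ r q (X (g j) c) := fun c i j hij h₁ h₂ =>
    (hg i j hij).2 c (two_mul r ▸ h₁.symm.trans h₂)
  -- Each of the coordinates `a` and `b` excludes at most one index, so three indices suffice.
  obtain ⟨i, hi3, hia, hib⟩ : ∃ i < 3, ¬ WalkJoined G Sᶜ r q (X (g i) a) ∧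
      ¬ WalkJoined G Sᶜ r q (X (g i) b) := by
    have h01 := fun c => hnear c 0 1 (by norm_num)
    have h02 := fun c => hnear c 0 2 (by norm_num)
    have h12 := fun c => hnear c 1 2 (by norm_num)
    by_contra! hne
    have h0 := hne 0 (by norm_num)
    have h1 := hne 1 (by norm_num)
    have h2 := hne 2 (by norm_num)
    have := h01 a; have := h02 a; have := h12 a
    have := h01 b; have := h02 b; have := h12 b
    tauto
  have him : g i ≤ m := by interval_cases i <;> simp [m]
  obtain ⟨hgi, hsa', hsb'⟩ := (hg i (i + 1) (Nat.lt_succ_self i)).1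
  obtain ⟨s₁, -, p₁, q₁, hd, hq₁, hj₁⟩ :=
    hthrough _ hgi q a d (by omega) (hqs _ him a d (by omega) hsa') hia
  obtain ⟨s₂, -, p₂, q₂, he, hq₂, hj₂⟩ :=
    hthrough _ hgi q b e (by omega) (hqs _ him b e (by omega) hsb') hib
  obtain ⟨j, hmj, h₁, h₂⟩ := (((eventually_gt_atTop m).filter_mono hU).and (hj₁.and hj₂)).exists
  exact hX m j hmj q hq ⟨a, b, hab, d, e, hde, hd ▸ hq₁.trans h₁, he ▸ hq₂.trans h₂⟩

end

/-! ### Ultraproducts of graphs -/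

section Ultraproduct

variable {U : Ultrafilter ℕ} {V : ℕ → Type u} (G : ∀ n, SimpleGraph (V n))

/-- A sequence representing an element of an ultraproduct. -/
noncomputable def ultraproductRep (x : (U : Filter ℕ).Product V) : ∀ n, V n :=
  Quotient.out (s := productSetoid (U : Filter ℕ) V) x

/-- The element of an ultraproduct represented by a sequence. -/
def ultraproductMk (U : Ultrafilter ℕ) (x : ∀ n, V n) : (U : Filter ℕ).Product V :=
  Quotient.mk (productSetoid (U : Filter ℕ) V) x

theorem ultraproductRep_mk (x : ∀ n, V n) :
    ∀ᶠ n in U, ultraproductRep (ultraproductMk U x) n = x n :=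
  Quotient.mk_out (s := productSetoid (U : Filter ℕ) V) x

theorem eventually_rep_eq_iff {x y : (U : Filter ℕ).Product V} :
    (∀ᶠ n in U, ultraproductRep x n = ultraproductRep y n) ↔ x = y :=
  Quotient.out_equiv_out (s := productSetoid (U : Filter ℕ) V)

variable (U) in
/-- The ultraproduct of a sequence of graphs. -/
def ultraproductGraph : SimpleGraph ((U : Filter ℕ).Product V) where
  Adj x y := ∀ᶠ n in U, (G n).Adj (ultraproductRep x n) (ultraproductRep y n)
  symm := ⟨fun _ _ h => h.mono fun _ h => h.symm⟩
  loopless := ⟨fun x h => by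
    obtain ⟨n, hn⟩ := h.exists
    exact hn.ne rfl⟩

variable {G}

theorem WalkJoined.eventually_rep {A : Set ((U : Filter ℕ).Product V)} {d : ℕ}
    {x y : (U : Filter ℕ).Product V} (h : WalkJoined (ultraproductGraph U G) A d x y) :
    ∀ᶠ n in U, WalkJoined (G n) ((ultraproductRep · n) '' A) d
      (ultraproductRep x n) (ultraproductRep y n) := by
  induction d generalizing y with
  | zero =>
    obtain ⟨rfl, hx⟩ := h
    exact .of_forall fun n => ⟨rfl, x, hx, rfl⟩
  | succ d ih =>
    obtain ⟨z, h, hz, hy⟩ := h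
    rcases hz with rfl | hz
    · exact (ih h).mono fun n hn => hn.succ
    · filter_upwards [ih h, hz] with n hn hzn
      exact ⟨_, hn, Or.inr hzn, y, hy, rfl⟩

/-- Penultimate vertices chosen coordinatewise assemble into one vertex of the ultraproduct; the
ultrafilter then decides between staying and moving. -/
theorem WalkJoined.of_eventually {d : ℕ} {x y : (U : Filter ℕ).Product V}
    (h : ∀ᶠ n in U, WalkJoined (G n) Set.univ d (ultraproductRep x n) (ultraproductRep y n)) :
    WalkJoined (ultraproductGraph U G) Set.univ d x y := by
  induction d generalizing y with
  | zero => exact ⟨eventually_rep_eq_iff.1 (h.mono fun n hn => hn.1), trivial⟩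
  | succ d ih =>
    have hz : ∀ n, ∃ z : V n, WalkJoined (G n) Set.univ (d + 1) (ultraproductRep x n)
        (ultraproductRep y n) → WalkJoined (G n) Set.univ d (ultraproductRep x n) z ∧
          (z = ultraproductRep y n ∨ (G n).Adj z (ultraproductRep y n)) := by
      intro n
      by_cases hn : WalkJoined (G n) Set.univ (d + 1) (ultraproductRep x n) (ultraproductRep y n)
      · obtain ⟨z, h, hz, -⟩ := hn
        exact ⟨z, fun _ => ⟨h, hz⟩⟩
      · exact ⟨ultraproductRep y n, fun h => absurd h hn⟩
    choose z hz using hz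
    have hrep := ultraproductRep_mk (U := U) z
    refine ⟨ultraproductMk U z, ih ?_, ?_, trivial⟩
    · filter_upwards [h, hrep] with n hn hzn
      exact hzn ▸ (hz n hn).1
    · have : ∀ᶠ n in U, ultraproductRep (ultraproductMk U z) n = ultraproductRep y n ∨
          (G n).Adj (ultraproductRep (ultraproductMk U z) n) (ultraproductRep y n) := by
        filter_upwards [h, hrep] with n hn hzn
        exact hzn ▸ (hz n hn).2
      exact (Ultrafilter.eventually_or.1 this).imp eventually_rep_eq_iff.1 id

/-- With finite branch sets, disjointness is finitely many inequalities, which hold simultaneously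
in almost every factor. -/
theorem HasCliqueModel.exists_finite {V : Type u} {G : SimpleGraph V} {r t : ℕ}
    (h : HasCliqueModel G r t) : ∃ (c : Fin t → V) (O : Fin t → Set V), (∀ h, (O h).Finite) ∧
    (∀ h, c h ∈ O h) ∧ (∀ g h, g < h → Disjoint (O g) (O h)) ∧
    ∀ g h, g < h → ∃ x y, WalkJoined G (O g) r (c g) x ∧ WalkJoined G (O h) r (c h) y ∧
      G.Adj x y := by
  obtain ⟨c, O, hc, hO, hadj⟩ := h
  have hF : ∀ g h, ∃ F F' : Set V, F ⊆ O g ∧ F' ⊆ O h ∧ F.Finite ∧ F'.Finite ∧ (g < h →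
      ∃ x y, WalkJoined G F r (c g) x ∧ WalkJoined G F' r (c h) y ∧ G.Adj x y) := by
    intro g h
    by_cases hgh : g < h
    · obtain ⟨x, y, hx, hy, hxy⟩ := hadj g h hgh
      obtain ⟨F, hFO, hF, hx⟩ := hx.exists_finite
      obtain ⟨F', hFO', hF', hy⟩ := hy.exists_finite
      exact ⟨F, F', hFO, hFO', hF, hF', fun _ => ⟨x, y, hx, hy, hxy⟩⟩
    · exact ⟨∅, ∅, Set.empty_subset _, Set.empty_subset _, Set.finite_empty, Set.finite_empty,
        fun h => absurd h hgh⟩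
  choose F F' hFO hFO' hF hF' hadj using hF
  have hsub : ∀ h, insert (c h) ((⋃ l, F h l) ∪ ⋃ g, F' g h) ⊆ O h := fun h =>
    Set.insert_subset (hc h)
      (Set.union_subset (Set.iUnion_subset (hFO h)) (Set.iUnion_subset fun g => hFO' g h))
  refine ⟨c, fun h => insert (c h) ((⋃ l, F h l) ∪ ⋃ g, F' g h), fun h => ?_,
    fun h => Set.mem_insert _ _, fun g h hgh => (hO g h hgh).mono (hsub g) (hsub h),
    fun g h hgh => ?_⟩
  · exact ((Set.finite_iUnion (hF h)).union (Set.finite_iUnion fun g => hF' g h)).insert _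
  · obtain ⟨x, y, hx, hy, hxy⟩ := hadj g h hgh
    exact ⟨x, y, hx.mono fun v hv => Or.inr (Or.inl (Set.mem_iUnion_of_mem h hv)),
      hy.mono fun v hv => Or.inr (Or.inr (Set.mem_iUnion_of_mem g hv)), hxy⟩

theorem HasCliqueModel.eventually {r t : ℕ} (h : HasCliqueModel (ultraproductGraph U G) r t) :
    ∀ᶠ n in U, HasCliqueModel (G n) r t := by
  obtain ⟨c, O, hfin, hc, hO, hadj⟩ := h.exists_finite
  have hdisj : ∀ᶠ n in U, ∀ g h, g < h → ∀ x ∈ O g, ∀ y ∈ O h,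
      ultraproductRep x n ≠ ultraproductRep y n := by
    refine eventually_all.2 fun g => eventually_all.2 fun h => eventually_imp_distrib_left.2
      fun hgh => (eventually_all_finite (hfin g)).2 fun x hx =>
        (eventually_all_finite (hfin h)).2 fun y hy => Ultrafilter.eventually_not.2 fun hxy => ?_
    exact Set.disjoint_left.1 (hO g h hgh) hx (eventually_rep_eq_iff.1 hxy ▸ hy)
  have hadj' : ∀ᶠ n in U, ∀ g h, g < h → ∃ x y : V n,
      WalkJoined (G n) ((ultraproductRep · n) '' O g) r (ultraproductRep (c g) n) x ∧
      WalkJoined (G n) ((ultraproductRep · n) '' O h) r (ultraproductRep (c h) n) y ∧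
      (G n).Adj x y := by
    refine eventually_all.2 fun g => eventually_all.2 fun h => eventually_imp_distrib_left.2
      fun hgh => ?_
    obtain ⟨x, y, hx, hy, hxy⟩ := hadj g h hgh
    filter_upwards [hx.eventually_rep, hy.eventually_rep, hxy] with n h₁ h₂ h₃
    exact ⟨_, _, h₁, h₂, h₃⟩
  filter_upwards [hdisj, hadj'] with n hn hn'
  refine ⟨fun h => ultraproductRep (c h) n, fun h => (ultraproductRep · n) '' O h,
    fun h => ⟨_, hc h, rfl⟩, fun g h hgh => Set.disjoint_left.2 ?_, hn'⟩
  rintro _ ⟨x, hx, rfl⟩ ⟨y, hy, hxy⟩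
  exact hn g h hgh x hx y hy hxy.symm

end Ultraproduct

/-! ### Transfer to the class -/

theorem exists_joined_of_not_independent {V : Type u} {G : SimpleGraph V} {k r : ℕ}
    (h : ¬ ∃ A : Finset V, A.card = k ∧ IsRIndependent G r (A : Set V)) (y : Fin k → V) :
    ∃ a b, a ≠ b ∧ WalkJoined G Set.univ r (y a) (y b) := by
  classical
  by_cases hy : Function.Injective y
  · by_contra! hcon
    refine h ⟨Finset.univ.map ⟨y, hy⟩, by simp, ?_⟩
    intro u hu v hv huv
    simp only [Finset.coe_map, Finset.coe_univ, Set.image_univ, Set.mem_range,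
      Function.Embedding.coeFn_mk] at hu hv
    obtain ⟨a, rfl⟩ := hu
    obtain ⟨b, rfl⟩ := hv
    by_contra! hle
    obtain ⟨p, hp⟩ := SimpleGraph.exists_walk_of_edist_ne_top
      (ne_top_of_le_ne_top (ENat.natCast_ne_top r) hle)
    refine hcon a b (fun hab => huv (congrArg y hab)) ((WalkJoined.of_walk p).le ?_)
    rw [← hp] at hle
    exact_mod_cast hle
  · simp only [Function.Injective, not_forall] at hy
    obtain ⟨a, b, hab, hne⟩ := hy
    refine ⟨a, b, hne, ?_⟩
    rw [← hab]
    exact (WalkJoined.refl (Set.mem_univ _)).le (Nat.zero_le r)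

theorem captures_of_capturesTuple {V : Type u} {G : SimpleGraph V} {k r : ℕ} {Q : Set V} {q : V}
    (hq : q ∈ Q) {X : Fin k → V} (hX : Function.Injective X) (h : CapturesTuple G r q X) :
    Captures G r Q (Set.range X) := by
  obtain ⟨a, b, hab, d, e, hde, hd, he⟩ := h
  obtain ⟨p₁, hp₁⟩ := hd.exists_walk
  obtain ⟨p₂, hp₂⟩ := he.exists_walk
  refine ⟨X a, ⟨a, rfl⟩, X b, ⟨b, rfl⟩, hX.ne hab, p₁.reverse.append p₂, ?_, q, hq, ?_⟩
  · simp only [SimpleGraph.Walk.length_append, SimpleGraph.Walk.length_reverse]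
    omega
  · simp

theorem theorem1p7 (k r : ℕ) (𝒞 : Set FiniteGraph.{u}) (h𝒞 : IsNowhereDenseClass 𝒞) :
    ∃ C : ℕ, ∀ G ∈ 𝒞,
      (¬ ∃ A : Finset G.V, A.card = k ∧ IsRIndependent G.graph r (A : Set G.V)) →
        ∃ Q : Finset G.V, Q.card ≤ C ∧ IsWitness G.graph k r (Q : Set G.V) := by
  classical
  by_contra! hcon
  choose G hG𝒞 hind hwit using hcon
  let U : Ultrafilter ℕ := hyperfilter ℕ
  let H := ultraproductGraph U fun n => (G n).graph
  have hclique : ∀ s, ∃ t, ¬ HasCliqueModel H s t := by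
    intro s
    obtain ⟨t, ht⟩ := h𝒞 s
    refine ⟨t, fun h => ?_⟩
    obtain ⟨n, hn⟩ := h.eventually.exists
    exact ht (G n) (hG𝒞 n) hn.isShallowMinor
  have hjoin : ∀ y : Fin k → (U : Filter ℕ).Product fun n => (G n).V,
      ∃ a b, a ≠ b ∧ WalkJoined H Set.univ r (y a) (y b) := by
    intro y
    have hy : ∀ᶠ n in U, ∃ a b, a ≠ b ∧ WalkJoined (G n).graph Set.univ r
        (ultraproductRep (y a) n) (ultraproductRep (y b) n) :=
      .of_forall fun n => exists_joined_of_not_independent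
        (by simpa only [not_exists, not_and] using hind n) fun a => ultraproductRep (y a) n
    -- The joined pair depends on `n`; as there are finitely many pairs, the ultrafilter selects
    -- one.
    obtain ⟨a, ha⟩ := Ultrafilter.eventually_exists_iff.1 hy
    obtain ⟨b, hb⟩ := Ultrafilter.eventually_exists_iff.1 ha
    obtain ⟨n, hn⟩ := hb.exists
    exact ⟨a, b, hn.1, .of_eventually (hb.mono fun n hn => hn.2)⟩
  obtain ⟨Q, hQ⟩ := exists_finset_forall_capturesTuple hclique hjoin
  have hX : ∀ n, ∃ X : Fin k → (G n).V, Function.Injective X ∧ (Q.card ≤ n →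
      ¬ Captures (G n).graph r
        ((Q.image fun q => ultraproductRep q n : Finset (G n).V) : Set (G n).V) (Set.range X)) := by
    intro n
    have hex : ∀ R : Finset (G n).V, R.card ≤ n → ∃ X : Fin k → (G n).V, Function.Injective X ∧
        ¬ Captures (G n).graph r (R : Set (G n).V) (Set.range X) := by
      intro R hR
      have hw := hwit n R hR
      simp only [IsWitness, not_forall] at hw
      obtain ⟨X, hXk, hX⟩ := hw
      refine ⟨fun a => X.equivFinOfCardEq hXk |>.symm a,
        Subtype.val_injective.comp (Equiv.injective _), ?_⟩
      convert hX
      ext v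
      constructor
      · rintro ⟨a, rfl⟩
        exact Subtype.property _
      · intro hv
        exact ⟨X.equivFinOfCardEq hXk ⟨v, hv⟩, by simp⟩
    by_cases hn : Q.card ≤ n
    · obtain ⟨X, hX, hXc⟩ := hex _ (Finset.card_image_le.trans hn)
      exact ⟨X, hX, fun _ => hXc⟩
    -- For small `n` any injective tuple serves as a filler.
    · obtain ⟨X, hX, -⟩ := hex ∅ (Nat.zero_le n)
      exact ⟨X, hX, fun h => absurd h hn⟩
  choose X hXinj hXc using hX
  obtain ⟨q, hq, a, b, hab, d, e, hde, hd, he⟩ := hQ fun a => ultraproductMk U fun n => X n a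
  obtain ⟨n, hn, hdn, hen, hna, hnb⟩ := (((eventually_ge_atTop Q.card).filter_mono
    Nat.hyperfilter_le_atTop).and (hd.eventually_rep.and (he.eventually_rep.and
      ((ultraproductRep_mk fun n => X n a).and (ultraproductRep_mk fun n => X n b))))).exists
  rw [hna] at hdn
  rw [hnb] at hen
  exact hXc n hn (captures_of_capturesTuple (Finset.mem_image_of_mem _ hq) (hXinj n)
    ⟨a, b, hab, d, e, hde, hdn.mono (Set.subset_univ _), hen.mono (Set.subset_univ _)⟩)
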